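/- For nonzero integers $a,b,c,d,e,f$ let $$G(a,b;c,d;e,f)=\langle x,y,z \mid (x^a)^y=x^b,\ (y^c)^z=y^d,\ (z^e)^x=z^f\rangle ,$$ where $g^h$ means $h^{-1}gh$. It is the direct limit of the triangle of groups with vertex groups the Baumslag–Solitar groups $\langle x,y\mid (x^a)^y=x^b\rangle$, $\langle y,z\mid (y^c)^z=y^d\rangle$, $\langle z,x\mid (z^e)^x=z^f\rangle$, edge groups the infinite cyclic groups $\langle x\rangle,\langle y\rangle,\langle z\rangle$, and trivial face group. The triangle is called developable if the natural homomorphism from each of the three vertex groups to $G(a,b;c,d;e,f)$ is injective. Regard $a$ and $b$ as partners, and similarly $c$ and $d$, and $e$ and $f$. Suppose that one of $a,\dots,f$ divides its partner. Then the triangle of groups $G(a,b;c,d;e,f)$ is not developable, except in the special cases 1. $G(a,-a;c,-c;e,-e)$, 2. $G(a,b;c,c;e,e)$, 3. $G(a,b;c,c;e,-e)$ with $a\equiv b \pmod 2$, 4. $G(a,b;c,-c;e,e)$ with $e$ even, 5. $G(a,b;c,-c;e,-e)$ with $e$ even and $a\equiv b\pmod 2$, and those obtained from these by any finite sequence of the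 following transformations: cyclic permutation of the three pairs $(a,b),(c,d),(e,f)$; exchange of one of $a,\dots,f$ with its partner; simultaneous negation of one of $a,\dots,f$ and its partner. All of these special cases are developable. -/

import Mathlib

namespace BSTriangle

/-- The word `v⁻¹ u ^ p v (u ^ q)⁻¹` in the free group on `α`. Imposing it as a relator imposes
the relation `(u ^ p) ^ v = u ^ q`, where `g ^ h` means `h⁻¹ g h`. -/
def bsWord {α : Type} (u v : α) (p q : ℤ) : FreeGroup α :=
  (FreeGroup.of v)⁻¹ * FreeGroup.of u ^ p * FreeGroup.of v * (FreeGroup.of u ^ q)⁻¹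

/-- The Baumslag-Solitar group `BS(p, q) = ⟨u, v | (u ^ p) ^ v = u ^ q⟩`; the generators `u`, `v`
are numbered `0`, `1`. -/
abbrev BS (p q : ℤ) : Type :=
  PresentedGroup ({bsWord 0 1 p q} : Set (FreeGroup (Fin 2)))

/-- The three relators of `G(a,b;c,d;e,f)`; the generators `x`, `y`, `z` are numbered
`0`, `1`, `2`. -/
def relators (a b c d e f : ℤ) : Set (FreeGroup (Fin 3)) :=
  {bsWord 0 1 a b, bsWord 1 2 c d, bsWord 2 0 e f}

/-- The group `G(a,b;c,d;e,f) = ⟨x, y, z | (x ^ a) ^ y = x ^ b, (y ^ c) ^ z = y ^ d,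
(z ^ e) ^ x = z ^ f⟩`, the direct limit of the triangle of groups. -/
abbrev G (a b c d e f : ℤ) : Type :=
  PresentedGroup (relators a b c d e f)

/-- If `bsWord i j p q` is a relator of a presented group, this is the homomorphism from
`BS(p, q)` to that group sending `u` to the generator `i` and `v` to the generator `j`. -/
def ofBS {α : Type} {R : Set (FreeGroup α)} (i j : α) (p q : ℤ) (h : bsWord i j p q ∈ R) :
    BS p q →* PresentedGroup R :=
  PresentedGroup.toGroup (f := ![PresentedGroup.of i, PresentedGroup.of j]) (by
    intro r hr
    rw [Set.mem_singleton_iff] at hr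
    subst hr
    have h1 : PresentedGroup.mk R (bsWord i j p q) = 1 := PresentedGroup.one_of_mem h
    simpa [bsWord, PresentedGroup.of] using h1)

/-- The natural map from the vertex group `⟨x, y | (x ^ a) ^ y = x ^ b⟩` to `G(a,b;c,d;e,f)`. -/
def vertexXY (a b c d e f : ℤ) : BS a b →* G a b c d e f :=
  ofBS 0 1 a b (by simp [relators])

/-- The natural map from the vertex group `⟨y, z | (y ^ c) ^ z = y ^ d⟩` to `G(a,b;c,d;e,f)`. -/
def vertexYZ (a b c d e f : ℤ) : BS c d →* G a b c d e f :=
  ofBS 1 2 c d (by simp [relators])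

/-- The natural map from the vertex group `⟨z, x | (z ^ e) ^ x = z ^ f⟩` to `G(a,b;c,d;e,f)`. -/
def vertexZX (a b c d e f : ℤ) : BS e f →* G a b c d e f :=
  ofBS 2 0 e f (by simp [relators])

/-- The triangle of groups is developable if each vertex group injects into the direct limit. -/
def Developable (a b c d e f : ℤ) : Prop :=
  Function.Injective (vertexXY a b c d e f) ∧
  Function.Injective (vertexYZ a b c d e f) ∧
  Function.Injective (vertexZX a b c d e f)

/-- The special cases: five families of parameters, together with everything obtained from them
by repeatedly applying the trivial transformations, namely cyclic permutation of the three pairs,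
exchange of the two members of a pair, and simultaneous negation of both members of a pair.
(As cyclic permutation is among them, it suffices to exchange or negate in the first pair.) -/
inductive IsSpecial : ℤ → ℤ → ℤ → ℤ → ℤ → ℤ → Prop
  | case1 (a c e : ℤ) : IsSpecial a (-a) c (-c) e (-e)
  | case2 (a b c e : ℤ) : IsSpecial a b c c e e
  | case3 (a b c e : ℤ) : a ≡ b [ZMOD 2] → IsSpecial a b c c e (-e)
  | case4 (a b c e : ℤ) : Even e → IsSpecial a b c (-c) e e
  | case5 (a b c e : ℤ) : Even e → a ≡ b [ZMOD 2] → IsSpecial a b c (-c) e (-e)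
  | rotate (a b c d e f : ℤ) : IsSpecial a b c d e f → IsSpecial c d e f a b
  | exchange (a b c d e f : ℤ) : IsSpecial a b c d e f → IsSpecial b a c d e f
  | negate (a b c d e f : ℤ) : IsSpecial a b c d e f → IsSpecial (-a) (-b) c d e f

end BSTriangle

namespace BSTriangle

/-! ### Universal properties, and infinite order of the generators in the vertex groups. -/

section Homs

variable {Γ : Type*} [Group Γ]

/-! Necessity. By symmetry let b = ak, and let X be the power of x with exponent 2|a|, so that X^y =
X^k and X⁻¹yⁿX = yⁿX^(1-kⁿ). Conjugation by X takes some z^E to z^F, with E = F only if |e| = |f|.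
Choose M with (y^M)^(z^E) = y^P and (y^M)^(z^F) = y^Q. Conjugating the first relation by X and
dividing by the second shows that z^F conjugates X^(1-k^M) to R = y^(P-Q) X^(1-k^P). As y^M raises X
to the power k^M, y^Q does the same to R. If the vertex group embeds, the exponent sum of y there
yields (P-Q)(k^M-1) = 0, whence |c| = |d| or |e| = |f| (`natAbs_eq_or_natAbs_eq`). If |k| ≠ 1,
variants of this give both equalities; if |k| = 1, then |a| = |b|. So two of the three pairs always
agree up to sign. If the third does not, letting commuting or inverting powers act on each other
gives the parity conditions (`modEq_two`, `natAbs_ab_eq_of_odd`).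

Sufficiency. A vertex group either is a retract of G, or embeds in an explicit amalgam to which G
maps, or is a BS(p, ±p). In the last, ⟨u^p⟩ is normal with quotient ℤ/p * ℤ, so it suffices that u
has infinite order in G and that some quotient of G contains this free product on the images of u
and v (`BS.injective_of_freelyGenerate`). Amalgams of small groups provide such quotients. -/

theorem lift_bsWord_eq_one {α : Type} {g : α → Γ} {i j : α} {p q : ℤ}
    (h : (g j)⁻¹ * g i ^ p * g j = g i ^ q) : FreeGroup.lift g (bsWord i j p q) = 1 := by
  simp [bsWord, h]

theorem rel_of_mem {α : Type} {R : Set (FreeGroup α)} {i j : α} {p q : ℤ}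
    (h : bsWord i j p q ∈ R) :
    (PresentedGroup.of j : PresentedGroup R)⁻¹ * PresentedGroup.of i ^ p * PresentedGroup.of j =
      PresentedGroup.of i ^ q := by
  have h1 : PresentedGroup.mk R (bsWord i j p q) = 1 := PresentedGroup.one_of_mem h
  rw [← mul_inv_eq_one]
  simpa [bsWord, PresentedGroup.of] using h1

namespace BS

variable {p q : ℤ}

/-- The generator `u` of `BS(p, q)`. -/
def u (p q : ℤ) : BS p q := PresentedGroup.of 0

/-- The generator `v` of `BS(p, q)`. -/
def v (p q : ℤ) : BS p q := PresentedGroup.of 1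

theorem rel (p q : ℤ) : (v p q)⁻¹ * u p q ^ p * v p q = u p q ^ q :=
  rel_of_mem (Set.mem_singleton _)

/-- The universal property of `BS(p, q)`. -/
def lift (g h : Γ) (H : h⁻¹ * g ^ p * h = g ^ q) : BS p q →* Γ :=
  PresentedGroup.toGroup (f := ![g, h]) (by
    intro r hr
    rw [Set.mem_singleton_iff] at hr
    subst hr
    exact lift_bsWord_eq_one (by simpa using H))

@[simp] theorem lift_u (g h : Γ) (H : h⁻¹ * g ^ p * h = g ^ q) : lift g h H (u p q) = g :=
  PresentedGroup.toGroup.of _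

@[simp] theorem lift_v (g h : Γ) (H : h⁻¹ * g ^ p * h = g ^ q) : lift g h H (v p q) = h :=
  PresentedGroup.toGroup.of _

theorem hom_ext {φ ψ : BS p q →* Γ} (hu : φ (u p q) = ψ (u p q)) (hv : φ (v p q) = ψ (v p q)) :
    φ = ψ := by
  refine PresentedGroup.ext fun i => ?_
  fin_cases i
  · exact hu
  · exact hv

/-- The exponent sum of `v`. -/
def exponent (p q : ℤ) : BS p q →* Multiplicative ℤ :=
  lift 1 (Multiplicative.ofAdd 1) (by simp)

@[simp] theorem exponent_u (p q : ℤ) : exponent p q (u p q) = 1 := lift_u _ _ _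

@[simp] theorem exponent_v (p q : ℤ) : exponent p q (v p q) = Multiplicative.ofAdd 1 :=
  lift_v _ _ _

theorem v_zpow_eq_one {n : ℤ} (h : v p q ^ n = 1) : n = 0 := by
  have := congrArg (exponent p q) h
  rw [map_zpow, exponent_v, ← ofAdd_zsmul, (exponent p q).map_one] at this
  simpa using congrArg Multiplicative.toAdd this

/-- The affine action of `BS(p, q)` on `ℚ`: `u` acts by translation, `v` by scaling. -/
noncomputable def affine (hp : p ≠ 0) (hq : q ≠ 0) : BS p q →* Equiv.Perm ℚ :=
  lift (Equiv.addRight (1 : ℚ)) (Equiv.mulRight₀ ((p : ℚ) / q) (by positivity)) (by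
    ext t
    have hp' : (p : ℚ) ≠ 0 := by exact_mod_cast hp
    have hq' : (q : ℚ) ≠ 0 := by exact_mod_cast hq
    simp [Equiv.Perm.mul_apply, Equiv.Perm.inv_def, add_mul]
    field_simp)

theorem u_zpow_eq_one (hp : p ≠ 0) (hq : q ≠ 0) {n : ℤ} (h : u p q ^ n = 1) : n = 0 := by
  have := congrArg (fun w => affine hp hq w 0) h
  simp only [map_zpow, affine, lift_u, map_one] at this
  simpa using this

end BS

variable {a b c d e f : ℤ}

namespace G

/-- The generator `x`. -/
def x (a b c d e f : ℤ) : G a b c d e f := PresentedGroup.of 0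

/-- The generator `y`. -/
def y (a b c d e f : ℤ) : G a b c d e f := PresentedGroup.of 1

/-- The generator `z`. -/
def z (a b c d e f : ℤ) : G a b c d e f := PresentedGroup.of 2

theorem rel_x (a b c d e f : ℤ) :
    (y a b c d e f)⁻¹ * x a b c d e f ^ a * y a b c d e f = x a b c d e f ^ b :=
  rel_of_mem (by simp [relators])

theorem rel_y (a b c d e f : ℤ) :
    (z a b c d e f)⁻¹ * y a b c d e f ^ c * z a b c d e f = y a b c d e f ^ d :=
  rel_of_mem (by simp [relators])

theorem rel_z (a b c d e f : ℤ) :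
    (x a b c d e f)⁻¹ * z a b c d e f ^ e * x a b c d e f = z a b c d e f ^ f :=
  rel_of_mem (by simp [relators])

/-- The universal property of `G(a,b;c,d;e,f)`. -/
def lift (g h k : Γ) (h1 : h⁻¹ * g ^ a * h = g ^ b) (h2 : k⁻¹ * h ^ c * k = h ^ d)
    (h3 : g⁻¹ * k ^ e * g = k ^ f) : G a b c d e f →* Γ :=
  PresentedGroup.toGroup (f := ![g, h, k]) (by
    intro r hr
    simp only [relators, Set.mem_insert_iff, Set.mem_singleton_iff] at hr
    rcases hr with rfl | rfl | rfl
    · exact lift_bsWord_eq_one (by simpa using h1)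
    · exact lift_bsWord_eq_one (by simpa using h2)
    · exact lift_bsWord_eq_one (by simpa using h3))

section

variable (g h k : Γ) (h1 : h⁻¹ * g ^ a * h = g ^ b) (h2 : k⁻¹ * h ^ c * k = h ^ d)
    (h3 : g⁻¹ * k ^ e * g = k ^ f)

@[simp] theorem lift_x : lift g h k h1 h2 h3 (x a b c d e f) = g := PresentedGroup.toGroup.of _
@[simp] theorem lift_y : lift g h k h1 h2 h3 (y a b c d e f) = h := PresentedGroup.toGroup.of _
@[simp] theorem lift_z : lift g h k h1 h2 h3 (z a b c d e f) = k := PresentedGroup.toGroup.of _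

end

end G

theorem ofBS_u {α : Type} {R : Set (FreeGroup α)} (i j : α) (p q : ℤ) (h : bsWord i j p q ∈ R) :
    ofBS i j p q h (BS.u p q) = PresentedGroup.of i := by simp [ofBS, BS.u]

theorem ofBS_v {α : Type} {R : Set (FreeGroup α)} (i j : α) (p q : ℤ) (h : bsWord i j p q ∈ R) :
    ofBS i j p q h (BS.v p q) = PresentedGroup.of j := by simp [ofBS, BS.v]

@[simp] theorem vertexXY_u : vertexXY a b c d e f (BS.u a b) = G.x a b c d e f :=
  ofBS_u ..

@[simp] theorem vertexXY_v : vertexXY a b c d e f (BS.v a b) = G.y a b c d e f :=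
  ofBS_v ..

@[simp] theorem vertexYZ_u : vertexYZ a b c d e f (BS.u c d) = G.y a b c d e f :=
  ofBS_u ..

@[simp] theorem vertexYZ_v : vertexYZ a b c d e f (BS.v c d) = G.z a b c d e f :=
  ofBS_v ..

@[simp] theorem vertexZX_u : vertexZX a b c d e f (BS.u e f) = G.z a b c d e f :=
  ofBS_u ..

@[simp] theorem vertexZX_v : vertexZX a b c d e f (BS.v e f) = G.x a b c d e f :=
  ofBS_v ..

end Homs

/-! ### Invariance of developability under the trivial transformations. -/

section Symmetry

variable {a b c d e f : ℤ}

theorem injective_of_comp_eq {A B C D : Type*} [Group A] [Group B] [Group C] [Group D]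
    {φ : A →* B} {ρ : B →* D} {σ : A →* C} {ψ : C →* D} (hσ : Function.Injective σ)
    (hψ : Function.Injective ψ) (h : ρ.comp φ = ψ.comp σ) : Function.Injective φ := by
  refine Function.Injective.of_comp (f := ρ) ?_
  have : (ρ ∘ φ) = ψ ∘ σ := congrArg DFunLike.coe h
  rw [this]
  exact hψ.comp hσ

theorem Developable.rotate (h : Developable a b c d e f) : Developable c d e f a b := by
  let ρ : G c d e f a b →* G a b c d e f :=
    G.lift (G.y a b c d e f) (G.z a b c d e f) (G.x a b c d e f)
      (G.rel_y ..) (G.rel_z ..) (G.rel_x ..)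
  have hid (A : Type) [Group A] : Function.Injective (MonoidHom.id A) := fun _ _ h => h
  refine ⟨injective_of_comp_eq (ρ := ρ) (hid _) h.2.1 (BS.hom_ext ?_ ?_),
    injective_of_comp_eq (ρ := ρ) (hid _) h.2.2 (BS.hom_ext ?_ ?_),
    injective_of_comp_eq (ρ := ρ) (hid _) h.1 (BS.hom_ext ?_ ?_)⟩ <;> simp [ρ]

theorem conj_inv_of_conj {Γ : Type*} [Group Γ] {g h k : Γ} (H : h⁻¹ * g * h = k) :
    h⁻¹⁻¹ * k * h⁻¹ = g := by
  rw [← H]; group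

/-- Replace y by its inverse; on the second vertex group this inverts the generator `u`. -/
theorem Developable.exchange (h : Developable a b c d e f) : Developable b a c d e f := by
  let ρ : G b a c d e f →* G a b c d e f :=
    G.lift (G.x a b c d e f) (G.y a b c d e f)⁻¹ (G.z a b c d e f)
      (conj_inv_of_conj (G.rel_x ..))
      (by
        have := congrArg (·⁻¹) (G.rel_y a b c d e f)
        simpa [mul_assoc] using this)
      (G.rel_z ..)
  let σ (p q : ℤ) : BS p q →* BS q p :=
    BS.lift (BS.u q p) (BS.v q p)⁻¹ (conj_inv_of_conj (BS.rel q p))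
  have hσ (p q : ℤ) : Function.Injective (σ p q) := by
    refine Function.HasLeftInverse.injective ⟨σ q p, fun w => ?_⟩
    have : (σ q p).comp (σ p q) = MonoidHom.id _ := BS.hom_ext (by simp [σ]) (by simp [σ])
    exact DFunLike.congr_fun this w
  let τ : BS c d →* BS c d :=
    BS.lift (BS.u c d)⁻¹ (BS.v c d) (by
      have := congrArg (·⁻¹) (BS.rel c d)
      simpa [mul_assoc] using this)
  have hτ : Function.Injective τ := by
    refine Function.HasLeftInverse.injective ⟨τ, fun w => ?_⟩
    have : τ.comp τ = MonoidHom.id _ := BS.hom_ext (by simp [τ]) (by simp [τ])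
    exact DFunLike.congr_fun this w
  have hid (A : Type) [Group A] : Function.Injective (MonoidHom.id A) := fun _ _ h => h
  refine ⟨injective_of_comp_eq (ρ := ρ) (hσ b a) h.1 (BS.hom_ext ?_ ?_),
    injective_of_comp_eq (ρ := ρ) hτ h.2.1 (BS.hom_ext ?_ ?_),
    injective_of_comp_eq (ρ := ρ) (hid _) h.2.2 (BS.hom_ext ?_ ?_)⟩ <;> simp [ρ, σ, τ]

theorem Developable.negate (h : Developable a b c d e f) : Developable (-a) (-b) c d e f := by
  let ρ : G (-a) (-b) c d e f →* G a b c d e f :=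
    G.lift (G.x a b c d e f) (G.y a b c d e f) (G.z a b c d e f)
      (by
        have := congrArg (·⁻¹) (G.rel_x a b c d e f)
        simpa [mul_assoc] using this)
      (G.rel_y ..) (G.rel_z ..)
  have hneg (p q : ℤ) : (BS.v p q)⁻¹ * BS.u p q ^ (-p) * BS.v p q = BS.u p q ^ (-q) := by
    have := congrArg (·⁻¹) (BS.rel p q)
    simpa [mul_assoc] using this
  let σ : BS (-a) (-b) →* BS a b := BS.lift (BS.u a b) (BS.v a b) (hneg a b)
  let τ : BS a b →* BS (-a) (-b) :=
    BS.lift (BS.u (-a) (-b)) (BS.v (-a) (-b)) (by simpa using hneg (-a) (-b))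
  have hσ : Function.Injective σ := by
    refine Function.HasLeftInverse.injective ⟨τ, fun w => ?_⟩
    have : τ.comp σ = MonoidHom.id _ := BS.hom_ext (by simp [σ, τ]) (by simp [σ, τ])
    exact DFunLike.congr_fun this w
  have hid (A : Type) [Group A] : Function.Injective (MonoidHom.id A) := fun _ _ h => h
  refine ⟨injective_of_comp_eq (ρ := ρ) hσ h.1 (BS.hom_ext ?_ ?_),
    injective_of_comp_eq (ρ := ρ) (hid _) h.2.1 (BS.hom_ext ?_ ?_),
    injective_of_comp_eq (ρ := ρ) (hid _) h.2.2 (BS.hom_ext ?_ ?_)⟩ <;> simp [ρ, σ]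

end Symmetry

/-! ### Conjugation identities in an arbitrary group. -/

section Conjugation

variable {Γ : Type*} [Group Γ]

/-- Throughout, `SemiconjBy h k g` encodes g^h = k. -/
theorem semiconjBy_of_conj {g h k : Γ} (H : h⁻¹ * g * h = k) : SemiconjBy h k g := by
  rw [SemiconjBy, ← H]; group

theorem semiconjBy_pow {g h : Γ} {p q : ℤ} (H : SemiconjBy h (g ^ q) (g ^ p)) (n : ℕ) (t : ℤ) :
    SemiconjBy (h ^ n) (g ^ (q ^ n * t)) (g ^ (p ^ n * t)) := by
  induction n generalizing t with
  | zero => simp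
  | succ n ih =>
    have h1 := ih (p * t)
    have h2 := H.zpow_right (q ^ n * t)
    rw [← zpow_mul, ← zpow_mul] at h2
    rw [show q * (q ^ n * t) = q ^ (n + 1) * t by ring,
      show p * (q ^ n * t) = q ^ n * (p * t) by ring] at h2
    rw [pow_succ, show p ^ (n + 1) * t = p ^ n * (p * t) by ring]
    exact h1.mul_left h2

/-- Even powers of the conjugator absorb the signs of p and q. -/
theorem semiconjBy_pow_of_even {g h : Γ} {p q : ℤ} (H : SemiconjBy h (g ^ q) (g ^ p)) {n : ℕ}
    (hn : Even n) (t : ℕ) :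
    SemiconjBy (h ^ n) (g ^ (q.natAbs ^ n * t)) (g ^ (p.natAbs ^ n * t)) := by
  have h1 := semiconjBy_pow H n t
  rw [← hn.pow_abs q, ← hn.pow_abs p, Int.abs_eq_natAbs, Int.abs_eq_natAbs] at h1
  exact_mod_cast h1

/-- This is the relation (y^M)^w = y^P conjugated by X, which turns w into w' and yⁿ into
yⁿX^(1-kⁿ). -/
theorem semiconjBy_conj_pow {X y w w' : Γ} {k : ℤ} {M P : ℕ}
    (hX : SemiconjBy X w' w) (hP : SemiconjBy w (y ^ P) (y ^ M))
    (hy : SemiconjBy y (X ^ k) X) :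
    SemiconjBy w' (y ^ P * X ^ (1 - k ^ P)) (y ^ M * X ^ (1 - k ^ M)) := by
  have key (n : ℕ) : y ^ n * X ^ (1 - k ^ n) = X⁻¹ * y ^ n * X := by
    have h1 := semiconjBy_pow (g := X) (p := 1) (q := k) (by simpa using hy) n (-1)
    have h2 : y ^ n * X ^ (k ^ n * -1) = X ^ (1 ^ n * -1 : ℤ) * y ^ n := h1
    rw [show (1 : ℤ) - k ^ n = k ^ n * -1 + 1 by ring, zpow_add, ← mul_assoc, h2]
    simp
  rw [key, key]
  have hw : w' = X⁻¹ * w * X := by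
    rw [mul_assoc, ← hX.eq]; group
  have h2 : w * y ^ P = y ^ M * w := hP
  rw [SemiconjBy, hw]
  calc _ = X⁻¹ * (w * y ^ P) * X := by group
    _ = _ := by rw [h2]; group

theorem semiconjBy_quotient {X y w' : Γ} {k : ℤ} {M P Q : ℕ}
    (h : SemiconjBy w' (y ^ P * X ^ (1 - k ^ P)) (y ^ M * X ^ (1 - k ^ M)))
    (hQ : SemiconjBy w' (y ^ Q) (y ^ M)) :
    SemiconjBy w' (y ^ ((P : ℤ) - Q) * X ^ (1 - k ^ P)) (X ^ (1 - k ^ M)) := by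
  have := hQ.inv_right.mul_right h
  rw [inv_mul_cancel_left] at this
  rwa [show (P : ℤ) - Q = -Q + P by ring, zpow_add, zpow_neg, zpow_natCast, zpow_natCast, mul_assoc]

/-- y^M raises X to the power k^M; conjugating by w' transports this to y^Q and R. -/
theorem semiconjBy_pow_quotient {X y w' R : Γ} {k j : ℤ} {M Q : ℕ}
    (h : SemiconjBy w' R (X ^ j)) (hQ : SemiconjBy w' (y ^ Q) (y ^ M))
    (hy : SemiconjBy y (X ^ k) X) : SemiconjBy (y ^ Q) (R ^ (k ^ M)) R := by
  have h1 := semiconjBy_pow (g := X) (p := 1) (q := k) (by simpa using hy) M j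
  rw [one_pow, one_mul] at h1
  have h2 := h.zpow_right (k ^ M)
  rw [← zpow_mul, mul_comm j] at h2
  have h3 := h.inv_symm_left.mul_left (h1.mul_left h2)
  have h4 : w'⁻¹ * (y ^ M * w') = y ^ Q := by
    rw [← hQ.eq]; group
  rwa [h4] at h3

end Conjugation

/-! ### Divisibility forces two pairs to agree up to sign. -/

section Developable

variable {a b c d e f : ℤ}

theorem Developable.x_zpow (h : Developable a b c d e f) (ha : a ≠ 0) (hb : b ≠ 0) {n : ℤ}
    (hn : G.x a b c d e f ^ n = 1) : n = 0 := by
  rw [← vertexXY_u, ← map_zpow] at hn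
  exact BS.u_zpow_eq_one ha hb (h.1 (hn.trans (map_one _).symm))

theorem Developable.y_zpow (h : Developable a b c d e f) {n : ℤ}
    (hn : G.y a b c d e f ^ n = 1) : n = 0 := by
  rw [← vertexXY_v, ← map_zpow] at hn
  exact BS.v_zpow_eq_one (h.1 (hn.trans (map_one _).symm))

theorem Developable.z_zpow (h : Developable a b c d e f) {n : ℤ}
    (hn : G.z a b c d e f ^ n = 1) : n = 0 := by
  rw [← vertexYZ_v, ← map_zpow] at hn
  exact BS.v_zpow_eq_one (h.2.1 (hn.trans (map_one _).symm))

theorem Developable.x_inj (h : Developable a b c d e f) (ha : a ≠ 0) (hb : b ≠ 0) {m n : ℤ}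
    (hn : G.x a b c d e f ^ m = G.x a b c d e f ^ n) : m = n :=
  sub_eq_zero.1 (h.x_zpow ha hb (by rw [zpow_sub, hn, mul_inv_cancel]))

theorem Developable.z_inj (h : Developable a b c d e f) {m n : ℤ}
    (hn : G.z a b c d e f ^ m = G.z a b c d e f ^ n) : m = n :=
  sub_eq_zero.1 (h.z_zpow (by rw [zpow_sub, hn, mul_inv_cancel]))

/-- The relation involves only x and y, so by injectivity it holds in BS(a, b), where exponent sums
of `v` can be compared. -/
theorem Developable.exponent_eq (h : Developable a b c d e f) {i j m : ℤ} {Q : ℕ}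
    (H : SemiconjBy (G.y a b c d e f ^ Q)
      ((G.y a b c d e f ^ i * G.x a b c d e f ^ j) ^ m)
      (G.y a b c d e f ^ i * G.x a b c d e f ^ j)) : i * m = i := by
  have h1 : vertexXY a b c d e f (BS.v a b ^ Q * (BS.v a b ^ i * BS.u a b ^ j) ^ m) =
      vertexXY a b c d e f ((BS.v a b ^ i * BS.u a b ^ j) * BS.v a b ^ Q) := by
    simpa using H.eq
  have h2 := congrArg (fun w => Multiplicative.toAdd (BS.exponent a b w)) (h.1 h1)
  simp only [map_mul, map_zpow, map_pow, BS.exponent_u, BS.exponent_v] at h2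
  simp at h2
  linarith

theorem semiconj_x (a b c d e f : ℤ) : SemiconjBy (G.y a b c d e f) (G.x a b c d e f ^ b)
    (G.x a b c d e f ^ a) := semiconjBy_of_conj (G.rel_x ..)

theorem semiconj_y (a b c d e f : ℤ) : SemiconjBy (G.z a b c d e f) (G.y a b c d e f ^ d)
    (G.y a b c d e f ^ c) := semiconjBy_of_conj (G.rel_y ..)

theorem semiconj_z (a b c d e f : ℤ) : SemiconjBy (G.x a b c d e f) (G.z a b c d e f ^ f)
    (G.z a b c d e f ^ e) := semiconjBy_of_conj (G.rel_z ..)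

theorem natAbs_eq_of_pow_mul_pow_eq {c d : ℤ} (hc : c ≠ 0) (hd : d ≠ 0) {E F : ℕ} (hEF : E ≠ F)
    (h : d.natAbs ^ E * c.natAbs ^ F = d.natAbs ^ F * c.natAbs ^ E) : c.natAbs = d.natAbs := by
  have hc' := Int.natAbs_pos.2 hc
  have hd' := Int.natAbs_pos.2 hd
  generalize c.natAbs = C at *
  generalize d.natAbs = D at *
  wlog hlt : E < F generalizing E F
  · exact this hEF.symm h.symm (lt_of_le_of_ne (not_lt.1 hlt) hEF.symm)
  obtain ⟨n, rfl⟩ := Nat.exists_eq_add_of_lt hlt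
  have : C ^ (n + 1) = D ^ (n + 1) := by
    have hpos : 0 < D ^ E * C ^ E := by positivity
    apply Nat.eq_of_mul_eq_mul_left hpos
    calc _ = D ^ E * C ^ (E + n + 1) := by ring
      _ = _ := by rw [h]; ring
  exact Nat.pow_left_injective (Nat.succ_ne_zero n) this

theorem semiconj_y_pow (a b c d e f : ℤ) {n : ℕ} (hn : Even n) (t : ℕ) :
    SemiconjBy (G.z a b c d e f ^ n) (G.y a b c d e f ^ (d.natAbs ^ n * t))
      (G.y a b c d e f ^ (c.natAbs ^ n * t)) :=
  semiconjBy_pow_of_even (semiconj_y a b c d e f) hn t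

theorem semiconj_z_pow (a b c d e f : ℤ) {n : ℕ} (hn : Even n) (t : ℕ) :
    SemiconjBy (G.x a b c d e f ^ n) (G.z a b c d e f ^ (f.natAbs ^ n * t))
      (G.z a b c d e f ^ (e.natAbs ^ n * t)) :=
  semiconjBy_pow_of_even (semiconj_z a b c d e f) hn t

theorem semiconj_x_pow_mul (a k c d e f : ℤ) (r : ℕ) :
    SemiconjBy (G.y a (a * k) c d e f) ((G.x a (a * k) c d e f ^ (a.natAbs * r)) ^ k)
      (G.x a (a * k) c d e f ^ (a.natAbs * r)) := by
  have h := (semiconj_x a (a * k) c d e f).zpow_right (a.sign * r)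
  have h0 : ((a.natAbs * r : ℕ) : ℤ) = a * (a.sign * r) := by
    rw [← mul_assoc, Int.mul_sign_self]; push_cast; rfl
  rw [← zpow_mul, ← zpow_mul] at h
  rwa [← zpow_natCast, ← zpow_mul, h0, show a * (a.sign * r) * k = a * k * (a.sign * r) by ring]

theorem Developable.natAbs_eq_or_natAbs_eq {a k : ℤ} (h : Developable a (a * k) c d e f)
    (ha : a ≠ 0) (hc : c ≠ 0) (hd : d ≠ 0) :
    c.natAbs = d.natAbs ∨ e.natAbs = f.natAbs := by
  by_contra! hne
  obtain ⟨hcd, hef⟩ := hne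
  have hA : a.natAbs * 2 ≠ 0 := by have := Int.natAbs_pos.2 ha; omega
  have hy := semiconj_x_pow_mul a k c d e f 2
  -- The factors 2 here and below make the exponents even: this removes signs, and gives k^P = 1
  -- when k = -1.
  have hX := semiconj_z_pow a (a * k) c d e f (n := a.natAbs * 2) (by simp) 2
  set A := a.natAbs * 2
  have hEF : e.natAbs ^ A * 2 ≠ f.natAbs ^ A * 2 := fun H =>
    hef (Nat.pow_left_injective hA (Nat.eq_of_mul_eq_mul_right two_pos H))
  have hE : Even (e.natAbs ^ A * 2) := by simp
  have hF : Even (f.natAbs ^ A * 2) := by simp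
  set E := e.natAbs ^ A * 2
  set F := f.natAbs ^ A * 2
  -- The multipliers are chosen so that both relations start from the same y^M.
  have hP := semiconj_y_pow a (a * k) c d e f hE (c.natAbs ^ F * 2)
  have hQ := semiconj_y_pow a (a * k) c d e f hF (c.natAbs ^ E * 2)
  rw [show c.natAbs ^ F * (c.natAbs ^ E * 2) = c.natAbs ^ E * (c.natAbs ^ F * 2) by ring] at hQ
  have hM0 : c.natAbs ^ E * (c.natAbs ^ F * 2) ≠ 0 := by
    have := Int.natAbs_pos.2 hc; positivity
  have hMe : Even (c.natAbs ^ E * (c.natAbs ^ F * 2)) := by simp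
  have hPe : Even (d.natAbs ^ E * (c.natAbs ^ F * 2)) := by simp
  have hPQ : d.natAbs ^ E * (c.natAbs ^ F * 2) ≠ d.natAbs ^ F * (c.natAbs ^ E * 2) := fun H =>
    hcd (natAbs_eq_of_pow_mul_pow_eq hc hd hEF (by linarith))
  generalize c.natAbs ^ E * (c.natAbs ^ F * 2) = M at *
  generalize d.natAbs ^ E * (c.natAbs ^ F * 2) = P at *
  generalize d.natAbs ^ F * (c.natAbs ^ E * 2) = Q at *
  have h1 := semiconjBy_quotient (semiconjBy_conj_pow hX hP hy) hQ
  apply hPQ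
  by_cases hk : k ^ M = 1
  · have hk' : k ^ P = 1 := by
      rcases (pow_eq_one_iff_of_ne_zero hM0).1 hk with rfl | ⟨rfl, _⟩
      · simp
      · exact hPe.neg_one_pow
    simp only [hk, hk', sub_self, zpow_zero, mul_one] at h1
    have h2 := h.y_zpow ((SemiconjBy.eq_one_iff _ h1).2 rfl)
    omega
  · have h2 := semiconjBy_pow_quotient h1 hQ hy
    rw [← zpow_natCast _ A, ← zpow_mul] at h2
    have h3 := h.exponent_eq h2
    have h4 : ((P : ℤ) - Q) * (k ^ M - 1) = 0 := by linarith
    rcases mul_eq_zero.1 h4 with h5 | h5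
    · omega
    · exact absurd (by linarith) hk

/-- Now P = Q = M, so z^F commutes with a nontrivial power of x. But even powers of x rescale
exponents of z by powers of |f|/|e|. -/
theorem Developable.natAbs_ef_eq {a k : ℤ} (h : Developable a (a * k) c d e f)
    (ha : a ≠ 0) (hk : k.natAbs ≠ 1) (hc : c ≠ 0) (hf : f ≠ 0)
    (hcd : c.natAbs = d.natAbs) : e.natAbs = f.natAbs := by
  have hA : a.natAbs * 2 ≠ 0 := by have := Int.natAbs_pos.2 ha; omega
  have hy := semiconj_x_pow_mul a k c d e f 2
  have hX := semiconj_z_pow a (a * k) c d e f (n := a.natAbs * 2) (by simp) 2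
  set A := a.natAbs * 2
  have hE : Even (e.natAbs ^ A * 2) := by simp
  have hF : Even (f.natAbs ^ A * 2) := by simp
  have hF0 : f.natAbs ^ A * 2 ≠ 0 := by have := Int.natAbs_pos.2 hf; positivity
  set E := e.natAbs ^ A * 2
  set F := f.natAbs ^ A * 2
  have hP := semiconj_y_pow a (a * k) c d e f hE (c.natAbs ^ F)
  have hQ := semiconj_y_pow a (a * k) c d e f hF (c.natAbs ^ E)
  rw [← hcd] at hP hQ
  rw [mul_comm (c.natAbs ^ F)] at hQ
  have hM0 : c.natAbs ^ E * c.natAbs ^ F ≠ 0 := by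
    have := Int.natAbs_pos.2 hc; positivity
  generalize c.natAbs ^ E * c.natAbs ^ F = M at *
  have h1 := semiconjBy_quotient (semiconjBy_conj_pow hX hP hy) hQ
  simp only [sub_self, zpow_zero, one_mul] at h1
  have hk1 : k ^ M ≠ 1 := fun H => hk (by
    have := congrArg Int.natAbs H
    rw [Int.natAbs_pow] at this
    simpa [hM0] using this)
  rw [← zpow_natCast _ A, ← zpow_mul] at h1
  set m : ℤ := A * (1 - k ^ M) with hm
  have hm0 : m.natAbs ≠ 0 := by
    rw [Int.natAbs_ne_zero, hm]
    exact mul_ne_zero (by exact_mod_cast hA) (by intro H; exact hk1 (by linarith))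
  have h2 := semiconj_z_pow a (a * k) c d e f (n := m.natAbs * 2) (by simp) F
  have h3 : Commute (G.x a (a * k) c d e f ^ (m.natAbs * 2)) (G.z a (a * k) c d e f ^ F) := by
    have h4 : Commute (G.x a (a * k) c d e f ^ m) (G.z a (a * k) c d e f ^ F) :=
      Commute.symm h1
    have h5 := h4.zpow_left (m.sign * 2)
    rw [← zpow_mul, ← mul_assoc, Int.mul_sign_self] at h5
    exact_mod_cast h5
  have h6 := h3.pow_right (e.natAbs ^ (m.natAbs * 2))
  rw [← pow_mul, mul_comm F] at h6
  have h7 := mul_left_cancel (h2.eq.trans h6.eq.symm)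
  rw [← zpow_natCast, ← zpow_natCast] at h7
  have h8 := h.z_inj h7
  norm_cast at h8
  have h9 := Nat.eq_of_mul_eq_mul_right (Nat.pos_of_ne_zero hF0) h8
  exact (Nat.pow_left_injective (by omega) h9).symm

/-- Now X commutes with z^E, so the z^E-conjugate powers of y with exponents |c|^E and |d|^E act
alike on X. Compare the resulting exponents of k, where |k| ≥ 2. -/
theorem Developable.natAbs_cd_eq {a k : ℤ} (h : Developable a (a * k) c d e f)
    (ha : a ≠ 0) (hk0 : k ≠ 0) (hk : k.natAbs ≠ 1) (he : e ≠ 0)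
    (hef : e.natAbs = f.natAbs) : c.natAbs = d.natAbs := by
  have hA : a.natAbs * 2 ≠ 0 := by have := Int.natAbs_pos.2 ha; omega
  have hy := semiconj_x_pow_mul a k c d e f 2
  have hX := semiconj_z_pow a (a * k) c d e f (n := a.natAbs * 2) (by simp) 2
  rw [← hef] at hX
  set A := a.natAbs * 2
  have hE : Even (e.natAbs ^ A * 2) := by simp
  have hE0 : e.natAbs ^ A * 2 ≠ 0 := by have := Int.natAbs_pos.2 he; positivity
  generalize e.natAbs ^ A * 2 = E at *
  have hP := semiconj_y_pow a (a * k) c d e f hE 1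
  have hpow (n : ℕ) := semiconjBy_pow (p := 1) (q := k) (by simpa using hy) n 1
  simp only [one_pow, mul_one, zpow_one] at hpow hP
  set x := G.x a (a * k) c d e f
  set y := G.y a (a * k) c d e f
  set z := G.z a (a * k) c d e f
  set X := x ^ A
  have hw : Commute X (z ^ E) := hX
  have hyP : y ^ d.natAbs ^ E = (z ^ E)⁻¹ * y ^ c.natAbs ^ E * z ^ E := by
    rw [mul_assoc, ← hP.eq]; group
  have h1 : SemiconjBy (y ^ d.natAbs ^ E) (X ^ (k ^ (c.natAbs ^ E))) X := by
    rw [hyP]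
    exact (SemiconjBy.mul_left (hw.inv_right.symm) (hpow _)).mul_left (hw.symm.zpow_right _)
  have h2 := mul_left_cancel (h1.eq.trans (hpow (d.natAbs ^ E)).eq.symm)
  simp only [X] at h2
  rw [← zpow_natCast x A, ← zpow_mul, ← zpow_mul] at h2
  have h3 := h.x_inj ha (mul_ne_zero ha hk0) h2
  have h4 := mul_left_cancel₀ (by exact_mod_cast hA) h3
  have h5 := congrArg Int.natAbs h4
  rw [Int.natAbs_pow, Int.natAbs_pow] at h5
  have h6 := Nat.pow_right_injective (by have := Int.natAbs_pos.2 hk0; omega) h5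
  exact Nat.pow_left_injective hE0 h6

end Developable

/-! ### Parity conditions and the list of special cases. -/

section NonDevelopable

variable {a b c d e f : ℤ}

theorem commute_sq_of_semiconjBy {Γ : Type*} [Group Γ] {g h : Γ} {p q : ℤ}
    (hpq : q = p ∨ q = -p) (H : SemiconjBy h (g ^ q) (g ^ p)) : Commute (h ^ 2) (g ^ p) := by
  rw [pow_two]
  rcases hpq with rfl | rfl
  · exact H.mul_left H
  · have := H.inv_right
    rw [zpow_neg, inv_inv] at this
    rw [zpow_neg] at H
    exact H.mul_left this

/-- Some yⁿ commutes with z^e and conjugates x^A to x^B, where A, B have the parities of a, b. So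
x^A and x^B act alike on z^e, which x inverts. -/
theorem Developable.modEq_two (h : Developable a b c d e (-e)) (he : e ≠ 0)
    (hcd : d = c ∨ d = -c ∧ Even e) (hc : c ≠ 0) : a ≡ b [ZMOD 2] := by
  have hY : Commute (G.y a b c d e (-e) ^ c) (G.z a b c d e (-e) ^ e) := by
    rcases hcd with rfl | ⟨rfl, r, rfl⟩
    · exact (Commute.symm (semiconj_y a b d d e (-e))).zpow_right e
    · have := (commute_sq_of_semiconjBy (Or.inr rfl) (semiconj_y a b c (-c) (r + r)
        (-(r + r)))).symm.zpow_right r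
      rwa [← zpow_natCast, ← zpow_mul, Nat.cast_two, two_mul] at this
  have hYn : Commute (G.y a b c d e (-e) ^ (c.natAbs * 2)) (G.z a b c d e (-e) ^ e) := by
    have := hY.zpow_left (c.sign * 2)
    rw [← zpow_mul, ← mul_assoc, Int.mul_sign_self] at this
    exact_mod_cast this
  have hn : c.natAbs * 2 ≠ 0 := by have := Int.natAbs_pos.2 hc; omega
  have hx := semiconjBy_pow_of_even (semiconj_x a b c d e (-e)) (n := c.natAbs * 2) (by simp) 1
  set n := c.natAbs * 2
  have hz := semiconj_z a b c d e (-e)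
  have hA : (Even (a.natAbs ^ n * 1) ↔ Even a) := by simp [Nat.even_pow, hn]
  have hB : (Even (b.natAbs ^ n * 1) ↔ Even b) := by simp [Nat.even_pow, hn]
  generalize a.natAbs ^ n * 1 = A at *
  generalize b.natAbs ^ n * 1 = B at *
  set x := G.x a b c d e (-e)
  set y := G.y a b c d e (-e)
  set z := G.z a b c d e (-e)
  have hpow (m : ℕ) := semiconjBy_pow (g := z ^ e) (p := 1) (q := -1) (by simpa using hz) m 1
  simp only [one_pow, mul_one, zpow_one] at hpow
  have h1 : SemiconjBy (x ^ A) ((z ^ e) ^ (-1 : ℤ) ^ B) (z ^ e) := by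
    have : x ^ A = y ^ n * x ^ B * (y ^ n)⁻¹ := by rw [hx.eq]; group
    rw [this]
    exact (SemiconjBy.mul_left hYn (hpow B)).mul_left (hYn.inv_left.zpow_right _)
  have h2 := mul_left_cancel (h1.eq.trans (hpow A).eq.symm)
  rw [← zpow_mul, ← zpow_mul] at h2
  have h3 := mul_left_cancel₀ he (h.z_inj h2)
  have h4 : Even a ↔ Even b := by
    rw [← hA, ← hB]
    have h5 : (-1 : ℤ) ≠ 1 := by decide
    rw [← neg_one_pow_eq_one_iff_even h5, ← neg_one_pow_eq_one_iff_even h5, h3]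
  rw [Int.even_iff, Int.even_iff] at h4
  unfold Int.ModEq
  omega

/-- As e is odd, z^|e| inverts yⁿ, while it commutes with x². So yⁿ takes x^(2A) to x^(2B) and also
back, forcing A² = B². -/
theorem Developable.natAbs_ab_eq_of_odd (h : Developable a b c (-c) e f) (ha : a ≠ 0) (hb : b ≠ 0)
    (hc : c ≠ 0) (hef : f = e ∨ f = -e) (he : Odd e) : a.natAbs = b.natAbs := by
  have hz := commute_sq_of_semiconjBy hef (semiconj_z a b c (-c) e f)
  have hn : c.natAbs * 2 ≠ 0 := by have := Int.natAbs_pos.2 hc; omega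
  have hx := semiconjBy_pow_of_even (semiconj_x a b c (-c) e f) (n := c.natAbs * 2) (by simp) 2
  have hy := (semiconj_y a b c (-c) e f).zpow_right (c.sign * 2)
  rw [← zpow_mul, ← zpow_mul, neg_mul, ← mul_assoc, Int.mul_sign_self, zpow_neg] at hy
  have hy' : SemiconjBy (G.z a b c (-c) e f) (G.y a b c (-c) e f ^ (c.natAbs * 2))⁻¹
      (G.y a b c (-c) e f ^ (c.natAbs * 2)) := by exact_mod_cast hy
  set n := c.natAbs * 2
  have hA : a.natAbs ^ n = b.natAbs ^ n → a.natAbs = b.natAbs :=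
    fun H => Nat.pow_left_injective hn H
  apply hA
  generalize a.natAbs ^ n = A at *
  generalize b.natAbs ^ n = B at *
  set x := G.x a b c (-c) e f
  set y := G.y a b c (-c) e f
  set z := G.z a b c (-c) e f
  have h1 := semiconjBy_pow (g := y ^ n) (p := 1) (q := -1) (by simpa using hy') e.natAbs 1
  rw [(Int.natAbs_odd.2 he).neg_one_pow, one_pow, mul_one, mul_one, zpow_neg, zpow_one] at h1
  have hw : Commute (x ^ 2) (z ^ e.natAbs) := by
    have := hz.zpow_right e.sign
    rw [← zpow_mul, Int.mul_sign_self] at this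
    exact_mod_cast this
  set w := z ^ e.natAbs
  have hwA (m : ℕ) : Commute (x ^ (m * 2)) w := by
    rw [mul_comm, pow_mul]; exact hw.pow_left m
  have h2 : SemiconjBy (y ^ n)⁻¹ (x ^ (B * 2)) (x ^ (A * 2)) := by
    have : (y ^ n)⁻¹ = w⁻¹ * y ^ n * w := by rw [mul_assoc, ← h1.eq]; group
    rw [this]
    exact (SemiconjBy.mul_left (hwA A).symm.inv_left hx).mul_left (hwA B).symm
  have h3 := h2.inv_symm_left
  rw [inv_inv] at h3
  have h4 := (h3.pow_right A).eq
  have h5 := (hx.pow_right B).eq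
  rw [← pow_mul, ← pow_mul] at h4 h5
  rw [show B * 2 * A = A * 2 * B by ring, ← h5] at h4
  replace h5 := mul_left_cancel h4
  rw [← zpow_natCast, ← zpow_natCast] at h5
  have h6 := h.x_inj ha hb h5
  have h7 : A * A = B * B := by
    have : A * 2 * A = B * 2 * B := by exact_mod_cast h6
    linarith
  exact Nat.mul_self_inj.1 h7

/-- Every sign pattern is a rotation of case 1, 2 or 3; the parity condition in case 3 is automatic
for (a, -a). -/
theorem isSpecial_of_all_pairs (hab : b = a ∨ b = -a) (hcd : d = c ∨ d = -c)
    (hef : f = e ∨ f = -e) : IsSpecial a b c d e f := by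
  have h2 (a b c e : ℤ) : IsSpecial a b c c e e := .case2 a b c e
  have h3 (a c e : ℤ) : IsSpecial a (-a) c c e (-e) :=
    .case3 a (-a) c e (by unfold Int.ModEq; omega)
  rcases hab with rfl | rfl <;> rcases hcd with rfl | rfl <;> rcases hef with rfl | rfl
  · exact h2 ..
  · exact .rotate _ _ _ _ _ _ (h2 e (-e) b d)
  · exact .rotate _ _ _ _ _ _ (.rotate _ _ _ _ _ _ (h2 c (-c) f b))
  · exact .rotate _ _ _ _ _ _ (h3 e b c)
  · exact h2 ..
  · exact h3 ..
  · exact .rotate _ _ _ _ _ _ (.rotate _ _ _ _ _ _ (h3 c f a))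
  · exact .case1 ..

theorem Developable.isSpecial_of_two_pairs (h : Developable a b c d e f) (ha : a ≠ 0) (hb : b ≠ 0)
    (hc : c ≠ 0) (he : e ≠ 0) (hcd : d = c ∨ d = -c)
    (hef : f = e ∨ f = -e) : IsSpecial a b c d e f := by
  by_cases hab : a.natAbs = b.natAbs
  · exact isSpecial_of_all_pairs (Int.natAbs_eq_natAbs_iff.1 hab.symm) hcd hef
  rcases hcd with rfl | rfl
  · rcases hef with rfl | rfl
    · exact .case2 ..
    · exact .case3 _ _ _ _ (h.modEq_two he (Or.inl rfl) hc)
  · have hev : Even e := by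
      rw [← Int.not_odd_iff_even]
      exact fun ho => hab (h.natAbs_ab_eq_of_odd ha hb hc hef ho)
    rcases hef with rfl | rfl
    · exact .case4 _ _ _ _ hev
    · exact .case5 _ _ _ _ hev (h.modEq_two he (Or.inr ⟨rfl, hev⟩) hc)

theorem Developable.isSpecial_of_dvd (h : Developable a b c d e f)
    (ha : a ≠ 0) (hb : b ≠ 0) (hc : c ≠ 0) (hd : d ≠ 0) (he : e ≠ 0) (hf : f ≠ 0)
    (hab : a ∣ b) : IsSpecial a b c d e f := by
  have key : (c.natAbs = d.natAbs ∧ e.natAbs = f.natAbs) ∨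
      (a.natAbs = b.natAbs ∧ (c.natAbs = d.natAbs ∨ e.natAbs = f.natAbs)) := by
    obtain ⟨k, rfl⟩ := hab
    have hk0 : k ≠ 0 := right_ne_zero_of_mul hb
    have h1 := h.natAbs_eq_or_natAbs_eq ha hc hd
    by_cases hk : k.natAbs = 1
    · exact Or.inr ⟨by simp [Int.natAbs_mul, hk], h1⟩
    · rcases h1 with h1 | h1
      · exact Or.inl ⟨h1, h.natAbs_ef_eq ha hk hc hf h1⟩
      · exact Or.inl ⟨h.natAbs_cd_eq ha hk0 hk he h1, h1⟩
  have hpm {m n : ℤ} (H : m.natAbs = n.natAbs) : n = m ∨ n = -m :=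
    Int.natAbs_eq_natAbs_iff.1 H.symm
  rcases key with ⟨h1, h2⟩ | ⟨h1, h2 | h2⟩
  · exact h.isSpecial_of_two_pairs ha hb hc he (hpm h1) (hpm h2)
  · exact .rotate _ _ _ _ _ _ (h.rotate.rotate.isSpecial_of_two_pairs he hf ha hc (hpm h1) (hpm h2))
  · exact .rotate _ _ _ _ _ _ (.rotate _ _ _ _ _ _
      (h.rotate.isSpecial_of_two_pairs hc hd he ha (hpm h2) (hpm h1)))

theorem Developable.isSpecial_of_dvd_or_dvd (h : Developable a b c d e f)
    (ha : a ≠ 0) (hb : b ≠ 0) (hc : c ≠ 0) (hd : d ≠ 0) (he : e ≠ 0) (hf : f ≠ 0)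
    (hab : a ∣ b ∨ b ∣ a) : IsSpecial a b c d e f := by
  rcases hab with hab | hab
  · exact h.isSpecial_of_dvd ha hb hc hd he hf hab
  · exact .exchange _ _ _ _ _ _ (h.exchange.isSpecial_of_dvd hb ha hc hd he hf hab)

end NonDevelopable

/-! ### Amalgams, and an injectivity criterion for BS(p, ±p). -/

section FreeProducts

/-- `α` and `β` generate the free product of the cyclic groups generated by `α` and by `β`: the
relations between them follow from the relations which each of them satisfies. -/
def FreelyGenerate {Q : Type} [Group Q] (α β : Q) : Prop :=
  ∀ (K : Type) [Group K] (κ μ : K), (∀ n : ℤ, α ^ n = 1 → κ ^ n = 1) →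
    (∀ n : ℤ, β ^ n = 1 → μ ^ n = 1) →
      ∀ w : FreeGroup (Fin 2), FreeGroup.lift ![α, β] w = 1 → FreeGroup.lift ![κ, μ] w = 1

theorem exists_zpowers_hom {A B : Type} [Group A] [Group B] {α : A} {κ : B}
    (h : ∀ n : ℤ, α ^ n = 1 → κ ^ n = 1) :
    ∃ f : Subgroup.zpowers α →* B, ∀ n : ℤ,
      f ⟨α ^ n, Subgroup.zpow_mem_zpowers α n⟩ = κ ^ n := by
  let g : Subgroup.zpowers α := ⟨α, Subgroup.mem_zpowers α⟩
  have hg : ∀ x, x ∈ Subgroup.zpowers g := by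
    rintro ⟨_, n, rfl⟩
    exact ⟨n, Subtype.ext (by simp [g])⟩
  have hd : orderOf κ ∣ orderOf g := by
    rw [orderOf_dvd_iff_pow_eq_one, ← zpow_natCast]
    refine h _ ?_
    have : orderOf g = orderOf α := Subgroup.orderOf_mk _ _
    rw [this, zpow_natCast, pow_orderOf_eq_one]
  refine ⟨monoidHomOfForallMemZpowers hg hd, fun n => ?_⟩
  have : (⟨α ^ n, Subgroup.zpow_mem_zpowers α n⟩ : Subgroup.zpowers α) = g ^ n :=
    Subtype.ext (by simp [g])
  rw [this, map_zpow, monoidHomOfForallMemZpowers_apply_gen]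

open Monoid in
-- A reduced word with letters in the `H i` stays reduced in the pushout, because no nontrivial
-- letter lies in the amalgamated subgroup; the normal form theorem applies.
theorem lift_of_comp_subtype_injective {ι : Type*} {A : ι → Type*} [∀ i, Group (A i)] {C : Type*}
    [Group C] {φ : ∀ i, C →* A i} (hφ : ∀ i, Function.Injective (φ i)) (H : ∀ i, Subgroup (A i))
    (hH : ∀ i, ∀ g ∈ H i, g ∈ (φ i).range → g = 1) :
    Function.Injective
      (CoprodI.lift fun i => (PushoutI.of (φ := φ) i).comp (H i).subtype) := by
  classical
  rw [injective_iff_map_eq_one]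
  intro c hc
  obtain ⟨w, rfl⟩ := (CoprodI.Word.equiv (M := fun i => H i)).symm.surjective c
  let w' : CoprodI.Word A :=
    { toList := w.toList.map fun l => ⟨l.1, (l.2 : A l.1)⟩
      ne_one := by
        intro l hl
        obtain ⟨l', hl', rfl⟩ := List.mem_map.1 hl
        simpa using w.ne_one l' hl'
      chain_ne := by
        rw [List.isChain_map]
        exact w.chain_ne }
  have hred : PushoutI.Reduced φ w' := by
    intro l hl hmem
    obtain ⟨l', hl', rfl⟩ := List.mem_map.1 hl
    exact w.ne_one l' hl' (Subtype.ext (hH _ _ l'.2.2 hmem))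
  have hprod : PushoutI.ofCoprodI (φ := φ) w'.prod =
      CoprodI.lift (fun i => (PushoutI.of (φ := φ) i).comp (H i).subtype) w.prod := by
    simp [CoprodI.Word.prod, w', map_list_prod, Function.comp_def]
  have hw' := hred.eq_empty_of_mem_range hφ (by
    rw [hprod]
    exact ⟨1, by rw [map_one]; exact hc.symm⟩)
  have hw : w = .empty := by
    have := congrArg CoprodI.Word.toList hw'
    ext1
    simpa [w'] using this
  rw [hw]
  exact CoprodI.Word.prod_empty

/-- The family consisting of two types. -/
def Pair (A B : Type) (i : Bool) : Type := cond i A B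

instance (A B : Type) [Group A] [Group B] : ∀ i, Group (Pair A B i)
  | true => inferInstanceAs (Group A)
  | false => inferInstanceAs (Group B)

/-- Amalgamated free products along cyclic subgroups. -/
theorem exists_amalgam {A B : Type} [Group A] [Group B] (g : A) (h : B)
    (hgh : ∀ n : ℤ, g ^ n = 1 ↔ h ^ n = 1) :
    ∃ (P : Type) (_ : Group P) (i : A →* P) (j : B →* P), Function.Injective i ∧
      Function.Injective j ∧ i g = j h ∧ ∀ (α : A) (β : B), (∀ m n : ℤ, α ^ m = g ^ n → α ^ m = 1) →
        (∀ m n : ℤ, β ^ m = h ^ n → β ^ m = 1) → FreelyGenerate (i α) (j β) := by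
  obtain ⟨f, hf⟩ := exists_zpowers_hom fun n => (hgh n).1
  have hfi : Function.Injective f := by
    rw [injective_iff_map_eq_one]
    rintro ⟨_, n, rfl⟩ h1
    exact Subtype.ext ((hgh n).2 ((hf n).symm.trans h1))
  let φ : ∀ i, Subgroup.zpowers g →* Pair A B i := fun i =>
    match i with
    | true => (Subgroup.zpowers g).subtype
    | false => f
  have hφ : ∀ i, Function.Injective (φ i) := fun i =>
    match i with
    | true => Subtype.val_injective
    | false => hfi
  let i : A →* Monoid.PushoutI φ := Monoid.PushoutI.of (φ := φ) true
  let j : B →* Monoid.PushoutI φ := Monoid.PushoutI.of (φ := φ) false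
  have hi : Function.Injective i := Monoid.PushoutI.of_injective hφ true
  have hj : Function.Injective j := Monoid.PushoutI.of_injective hφ false
  refine ⟨Monoid.PushoutI φ, inferInstance, i, j, hi, hj, ?_, ?_⟩
  · have h1 : i g = Monoid.PushoutI.base φ ⟨g, Subgroup.mem_zpowers g⟩ :=
      Monoid.PushoutI.of_apply_eq_base φ true ⟨g, Subgroup.mem_zpowers g⟩
    have h2 : j (f ⟨g, Subgroup.mem_zpowers g⟩) =
        Monoid.PushoutI.base φ ⟨g, Subgroup.mem_zpowers g⟩ :=
      Monoid.PushoutI.of_apply_eq_base φ false ⟨g, Subgroup.mem_zpowers g⟩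
    have h3 := hf 1
    simp only [zpow_one] at h3
    rw [h1, ← h2, h3]
  intro α β hα hβ K _ κ μ hκ hμ w hw
  let H : ∀ i, Subgroup (Pair A B i) := fun i =>
    match i with
    | true => Subgroup.zpowers α
    | false => Subgroup.zpowers β
  have hH : ∀ i, ∀ g ∈ H i, g ∈ (φ i).range → g = 1 := fun i =>
    match i with
    | true => by
      rintro _ ⟨m, rfl⟩ ⟨⟨_, n, rfl⟩, h1⟩
      exact hα m n h1.symm
    | false => by
      rintro _ ⟨m, rfl⟩ ⟨⟨_, n, rfl⟩, h1⟩
      exact hβ m n (h1.symm.trans (hf n))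
  have hL := lift_of_comp_subtype_injective hφ H hH
  set L := Monoid.CoprodI.lift fun i => (Monoid.PushoutI.of (φ := φ) i).comp (H i).subtype
  obtain ⟨k, hk⟩ := exists_zpowers_hom (α := α) (κ := κ) fun n hn =>
    hκ n (by rw [← map_zpow, hn, map_one])
  obtain ⟨l, hl⟩ := exists_zpowers_hom (α := β) (κ := μ) fun n hn =>
    hμ n (by rw [← map_zpow, hn, map_one])
  let F : ∀ i, H i →* K := fun i =>
    match i with
    | true => k
    | false => l
  let α' : H true := ⟨α, Subgroup.mem_zpowers α⟩
  let β' : H false := ⟨β, Subgroup.mem_zpowers β⟩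
  let s : FreeGroup (Fin 2) →* Monoid.CoprodI fun i => H i :=
    FreeGroup.lift ![Monoid.CoprodI.of α', Monoid.CoprodI.of β']
  have h1 : L.comp s = FreeGroup.lift ![i α, j β] := by
    refine FreeGroup.ext_hom _ _ fun t => ?_
    fin_cases t
    · simp [s, L, α']; rfl
    · simp [s, L, β']; rfl
  have h2 : (Monoid.CoprodI.lift F).comp s = FreeGroup.lift ![κ, μ] := by
    refine FreeGroup.ext_hom _ _ fun t => ?_
    fin_cases t
    · have := hk 1
      simp only [zpow_one] at this
      simp only [Fin.zero_eta, MonoidHom.comp_apply, FreeGroup.lift_apply_of, s,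
        Matrix.cons_val_zero, Monoid.CoprodI.lift_of]
      exact this
    · have := hl 1
      simp only [zpow_one] at this
      simp only [Fin.mk_one, MonoidHom.comp_apply, FreeGroup.lift_apply_of, s,
        Matrix.cons_val_one]
      exact this
  -- The word already dies in ⟨α⟩ * ⟨β⟩, which maps to `K`.
  have h3 : s w = 1 := hL (by
    rw [map_one, ← hw, ← h1]; rfl)
  rw [← h2, MonoidHom.comp_apply, h3, map_one]

theorem BS.normal_zpowers {p q : ℤ} (hpq : q = p ∨ q = -p) :
    (Subgroup.zpowers (BS.u p q ^ p)).Normal := by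
  rw [← Subgroup.normalizer_eq_top_iff, eq_top_iff]
  intro w _
  refine PresentedGroup.generated_by _ _ (fun t => ?_) w
  fin_cases t
  · change BS.u p q ∈ _
    rw [Subgroup.mem_normalizer_iff_map_conj_eq, MonoidHom.map_zpowers]
    have h : (MulAut.conj (BS.u p q) : BS p q →* BS p q) (BS.u p q ^ p) = BS.u p q ^ p := by
      simp only [MonoidHom.coe_coe, MulAut.conj_apply]; group
    rw [h]
  · change BS.v p q ∈ _
    rw [← inv_mem_iff, Subgroup.mem_normalizer_iff_map_conj_eq, MonoidHom.map_zpowers]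
    have h : (MulAut.conj (BS.v p q)⁻¹ : BS p q →* BS p q) (BS.u p q ^ p) = BS.u p q ^ q := by
      rw [← BS.rel]; simp
    rw [h]
    rcases hpq with rfl | rfl
    · rfl
    · rw [zpow_neg, Subgroup.zpowers_inv]

/-- A homomorphism from `BS(p, ±p)` is injective if it is so on the powers of `u` and the images of
`u` and `v` in some quotient generate the free product `ℤ/p * ℤ`. -/
theorem BS.injective_of_freelyGenerate {p q : ℤ} (hpq : q = p ∨ q = -p)
    {Γ Q : Type} [Group Γ] [Group Q] (φ : BS p q →* Γ)
    (hu : ∀ n : ℤ, φ (BS.u p q) ^ n = 1 → n = 0) (ψ : Γ →* Q) {α β : Q}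
    (hψu : ψ (φ (BS.u p q)) = α) (hψv : ψ (φ (BS.v p q)) = β)
    (hα : ∀ n : ℤ, α ^ n = 1 → p ∣ n) (hβ : ∀ n : ℤ, β ^ n = 1 → n = 0)
    (hfree : FreelyGenerate α β) : Function.Injective φ := by
  rw [injective_iff_map_eq_one]
  intro w hw
  obtain ⟨w, rfl⟩ := PresentedGroup.mk_surjective _ w
  have := BS.normal_zpowers hpq
  let π := QuotientGroup.mk' (Subgroup.zpowers (BS.u p q ^ p))
  have h1 : ((ψ.comp φ).comp (PresentedGroup.mk _)) = FreeGroup.lift ![α, β] := by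
    refine FreeGroup.ext_hom _ _ fun t => ?_
    fin_cases t
    · simpa using! hψu
    · simpa using! hψv
  have h2 : π.comp (PresentedGroup.mk _) = FreeGroup.lift ![π (BS.u p q), π (BS.v p q)] := by
    refine FreeGroup.ext_hom _ _ fun t => ?_
    fin_cases t
    · simp; rfl
    · simp; rfl
  have h3 := hfree _ (π (BS.u p q)) (π (BS.v p q)) (fun n hn => by
      obtain ⟨m, rfl⟩ := hα n hn
      rw [← map_zpow]
      refine (QuotientGroup.eq_one_iff _).2 ?_
      rw [zpow_mul]
      exact Subgroup.zpow_mem_zpowers _ _) (fun n hn => by rw [hβ n hn, zpow_zero]) w (by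
      rw [← h1, MonoidHom.comp_apply, MonoidHom.comp_apply, hw, map_one])
  rw [← h2] at h3
  -- The kernel of φ thus lies in ⟨u^p⟩, where φ is injective.
  obtain ⟨m, hm⟩ := (QuotientGroup.eq_one_iff _).1 h3
  have h4 : BS.u p q ^ (p * m) = PresentedGroup.mk _ w := by rw [zpow_mul]; exact hm
  rw [← h4, map_zpow] at hw
  have h5 := hu _ hw
  rw [← h4, h5, zpow_zero]

end FreeProducts

/-! ### Explicit quotients proving the special cases developable. -/

section Examples

/-- Two commuting elements of given orders (with `0` for infinite order) generating their direct
product. -/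
theorem exists_commute (k l : ℤ) : ∃ (A : Type) (_ : Group A) (g α : A), Commute g α ∧
    (∀ n : ℤ, g ^ n = 1 ↔ k ∣ n) ∧ (∀ n : ℤ, α ^ n = 1 ↔ l ∣ n) ∧
      ∀ m n : ℤ, α ^ m = g ^ n → α ^ m = 1 := by
  refine ⟨Multiplicative (ZMod k.natAbs) × Multiplicative (ZMod l.natAbs), inferInstance,
    (Multiplicative.ofAdd 1, 1), (1, Multiplicative.ofAdd 1), Commute.all _ _, fun n => ?_,
    fun n => ?_, fun m n h => ?_⟩
  · rw [Prod.ext_iff]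
    simp [← ofAdd_zsmul, ZMod.intCast_zmod_eq_zero_iff_dvd]
  · rw [Prod.ext_iff]
    simp [← ofAdd_zsmul, ZMod.intCast_zmod_eq_zero_iff_dvd]
  · rw [Prod.ext_iff] at h ⊢
    simpa using h.2

/-- An element `ζ` of given even order (with `0` for infinite order) inverting an element `ρ` of
infinite order. -/
theorem exists_inverting {N : ℤ} (hN : Even N) : ∃ (B : Type) (_ : Group B) (ρ ζ : B),
    (∀ n : ℤ, ζ⁻¹ * ρ ^ n * ζ = ρ ^ (-n)) ∧ (∀ n : ℤ, ζ ^ n = 1 ↔ N ∣ n) ∧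
      ∀ m n : ℤ, ρ ^ m = ζ ^ n → m = 0 ∧ N ∣ n := by
  let ρ : DihedralGroup 0 := DihedralGroup.r 1
  let σ : DihedralGroup 0 := DihedralGroup.sr 0
  have hρ (n : ℤ) : ρ ^ n = DihedralGroup.r (Int.cast n : ZMod 0) :=
    DihedralGroup.r_one_zpow n
  have hσ : σ ^ (2 : ℤ) = 1 := by
    rw [zpow_two, DihedralGroup.sr_mul_sr, sub_self, DihedralGroup.one_def]
  have hσN (n : ℤ) (h : N ∣ n) : σ ^ n = 1 := by
    obtain ⟨m, rfl⟩ := (even_iff_two_dvd.1 hN).trans h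
    rw [zpow_mul, hσ, one_zpow]
  have hζ (n : ℤ) : ((σ, Multiplicative.ofAdd (1 : ZMod N.natAbs)) ^ n : _ × _).2 = 1 ↔ N ∣ n := by
    simp [← ofAdd_zsmul, ZMod.intCast_zmod_eq_zero_iff_dvd]
  -- The reflection σ inverts the rotation but has order 2; the cyclic factor raises the order of ζ
  -- to N.
  refine ⟨DihedralGroup 0 × Multiplicative (ZMod N.natAbs), inferInstance, (ρ, 1),
    (σ, Multiplicative.ofAdd 1), fun n => ?_, fun n => ⟨fun h => ?_, fun h => ?_⟩,
    fun m n h => ?_⟩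
  · rw [Prod.ext_iff]
    simp only [Prod.fst_mul, Prod.snd_mul, Prod.pow_fst, Prod.pow_snd, Prod.fst_inv, Prod.snd_inv,
      hρ, σ, DihedralGroup.inv_sr, DihedralGroup.sr_mul_r, DihedralGroup.sr_mul_sr]
    simp
  · exact (hζ n).1 (by rw [h]; rfl)
  · exact Prod.ext (hσN n h) ((hζ n).2 h)
  · have h2 : N ∣ n := (hζ n).1 (by rw [← h]; simp)
    have h1 := congrArg Prod.fst h
    simp only [Prod.pow_fst, hσN n h2, hρ, DihedralGroup.one_def] at h1
    refine ⟨?_, h2⟩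
    have h3 := DihedralGroup.r.inj h1
    rw [ZMod.intCast_zmod_eq_zero_iff_dvd] at h3
    simpa using h3

variable {a b c d e f : ℤ}

theorem zpow_eq_zpow_of_modEq {Γ : Type*} [Group Γ] {g : Γ} (hg : g ^ (2 : ℤ) = 1)
    (hab : a ≡ b [ZMOD 2]) : g ^ a = g ^ b := by
  obtain ⟨k, hk⟩ := hab.dvd
  rw [show b = a + 2 * k by linarith, zpow_add, zpow_mul, hg, one_zpow, mul_one]

theorem conj_eq_of_commute {Γ : Type*} [Group Γ] {g h : Γ} (H : Commute g h) : h⁻¹ * g * h = g := by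
  rw [mul_assoc, H.eq, inv_mul_cancel_left]

theorem BS.u_zpow_eq_v_zpow {p q m n : ℤ} (h : BS.u p q ^ m = BS.v p q ^ n) : n = 0 := by
  have := congrArg (BS.exponent p q) h
  rw [map_zpow, map_zpow, BS.exponent_u, one_zpow, BS.exponent_v, ← ofAdd_zsmul] at this
  simpa using (congrArg Multiplicative.toAdd this).symm

/-! ### Infinite order of the generators in G. -/

section InfiniteOrder

theorem z_zpow_eq_one_of_eq (hef : e = f) {n : ℤ} (hn : G.z a b c d e f ^ n = 1) : n = 0 := by
  let ψ : G a b c d e f →* Multiplicative ℤ :=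
    G.lift 1 1 (Multiplicative.ofAdd 1) (by simp) (by simp) (by simp [hef])
  have h := congrArg (fun w => Multiplicative.toAdd (ψ w)) hn
  simpa [ψ] using h

theorem y_zpow_eq_one_of_eq (hcd : c = d) {n : ℤ} (hn : G.y a b c d e f ^ n = 1) : n = 0 := by
  let ψ : G a b c d e f →* Multiplicative ℤ :=
    G.lift 1 (Multiplicative.ofAdd 1) 1 (by simp) (by simp [hcd]) (by simp)
  have h := congrArg (fun w => Multiplicative.toAdd (ψ w)) hn
  simpa [ψ] using h

theorem z_zpow_eq_one_of_neg (hab : a ≡ b [ZMOD 2]) {n : ℤ}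
    (hn : G.z a b c d e (-e) ^ n = 1) : n = 0 := by
  obtain ⟨B, _, ρ, ζ, h1, h2, h3⟩ := exists_inverting even_two
  let ψ : G a b c d e (-e) →* B :=
    G.lift ζ 1 ρ (by simpa using zpow_eq_zpow_of_modEq ((h2 2).2 dvd_rfl) hab) (by simp) (h1 e)
  have h := congrArg ψ hn
  rw [map_zpow, G.lift_z, map_one] at h
  exact (h3 n 0 (by simpa using h)).1

theorem y_zpow_eq_one_of_neg (he : Even e) (hf : Even f) {n : ℤ}
    (hn : G.y a b c (-c) e f ^ n = 1) : n = 0 := by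
  obtain ⟨B, _, ρ, ζ, h1, h2, h3⟩ := exists_inverting even_two
  let ψ : G a b c (-c) e f →* B :=
    G.lift 1 ρ ζ (by simp) (h1 c)
      (by simp [(h2 e).2 (even_iff_two_dvd.1 he), (h2 f).2 (even_iff_two_dvd.1 hf)])
  have h := congrArg ψ hn
  rw [map_zpow, G.lift_y, map_one] at h
  exact (h3 n 0 (by simpa using h)).1

theorem x_zpow_eq_one_of_neg {n : ℤ} (hn : G.x a (-a) c (-c) e f ^ n = 1) : n = 0 := by
  obtain ⟨B, _, ρ, ζ, h1, h2, h3⟩ := exists_inverting even_two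
  let ψ : G a (-a) c (-c) e f →* B :=
    G.lift ρ ζ 1 (h1 a)
      (zpow_eq_zpow_of_modEq (a := c) (b := -c) ((h2 2).2 dvd_rfl)
        (by unfold Int.ModEq; omega) ▸ by simp)
      (by simp)
  have h := congrArg ψ hn
  rw [map_zpow, G.lift_x, map_one] at h
  exact (h3 n 0 (by simpa using h)).1

end InfiniteOrder

/-! ### Injectivity of the individual vertex maps. -/

section Vertices

/-- Killing z retracts G onto the vertex group. -/
theorem vertexXY_injective_of_eq (hcd : c = d) :
    Function.Injective (vertexXY a b c d e f) := by
  let ρ : G a b c d e f →* BS a b :=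
    G.lift (BS.u a b) (BS.v a b) 1 (BS.rel a b) (by simp [hcd]) (by simp)
  have h : ρ.comp (vertexXY a b c d e f) = MonoidHom.id _ :=
    BS.hom_ext (by simp [ρ]) (by simp [ρ])
  exact Function.HasLeftInverse.injective ⟨ρ, DFunLike.congr_fun h⟩

theorem vertexYZ_injective_of_eq (hef : e = f) :
    Function.Injective (vertexYZ a b c d e f) := by
  let ρ : G a b c d e f →* BS c d :=
    G.lift 1 (BS.u c d) (BS.v c d) (by simp) (BS.rel c d) (by simp [hef])
  have h : ρ.comp (vertexYZ a b c d e f) = MonoidHom.id _ :=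
    BS.hom_ext (by simp [ρ]) (by simp [ρ])
  exact Function.HasLeftInverse.injective ⟨ρ, DFunLike.congr_fun h⟩

theorem conj_eq_of_eq_one {Γ : Type*} [Group Γ] {g h : Γ} {e f : ℤ} (hef : f = e ∨ f = -e)
    (hg : g ^ e = 1) : h⁻¹ * g ^ e * h = g ^ f := by
  rcases hef with rfl | rfl <;> simp [hg]

/-- Amalgamate BS(a, b) along y^c = ρ with a group in which an involution ζ inverts ρ. Sending z to
ζ kills z^e, since e is even. -/
theorem vertexXY_injective_of_neg (hc : c ≠ 0) (he : Even e) (hef : f = e ∨ f = -e) :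
    Function.Injective (vertexXY a b c (-c) e f) := by
  obtain ⟨B, _, ρ, ζ, h1, h2, h3⟩ := exists_inverting even_two
  obtain ⟨P, _, i, j, hi, -, hij, -⟩ := exists_amalgam (BS.v a b ^ c) ρ (fun n => by
    rw [← zpow_mul]
    refine ⟨fun h => ?_, fun h => ?_⟩
    · rw [(mul_eq_zero.1 (BS.v_zpow_eq_one h)).resolve_left hc, zpow_zero]
    · rw [(h3 n 0 (by simpa using h)).1, mul_zero, zpow_zero])
  let ψ : G a b c (-c) e f →* P :=
    G.lift (i (BS.u a b)) (i (BS.v a b)) (j ζ)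
      (by rw [← map_inv, ← map_zpow, ← map_mul, ← map_mul, BS.rel, map_zpow])
      (by
        rw [zpow_neg, ← map_zpow, hij, ← map_inv, ← map_inv, ← map_mul, ← map_mul]
        simpa using congrArg j (h1 1))
      (conj_eq_of_eq_one hef (by rw [← map_zpow, (h2 e).2 (even_iff_two_dvd.1 he), map_one]))
  have h : ψ.comp (vertexXY a b c (-c) e f) = i := BS.hom_ext (by simp [ψ]) (by simp [ψ])
  refine Function.Injective.of_comp (f := ψ) ?_
  rw [← MonoidHom.coe_comp, h]
  exact hi

/-- Adjoin to BS(a, b) an element of order |e| commuting with y^c, as the image of z. With x it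
generates ℤ/e * ℤ, since ⟨x⟩ meets ⟨y^c⟩ trivially. -/
theorem vertexZX_injective_of_eq (ha : a ≠ 0) (hb : b ≠ 0) (hc : c ≠ 0) (hef : f = e ∨ f = -e)
    (hz : ∀ n : ℤ, G.z a b c c e f ^ n = 1 → n = 0) :
    Function.Injective (vertexZX a b c c e f) := by
  obtain ⟨A, _, g, α, h0, h1, h2, h3⟩ := exists_commute 0 e
  obtain ⟨P, _, i, j, hi, hj, hij, hfree⟩ := exists_amalgam g (BS.v a b ^ c) (fun n => by
    rw [← zpow_mul, h1, zero_dvd_iff]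
    refine ⟨fun h => by simp [h], fun h => ?_⟩
    exact (mul_eq_zero.1 (BS.v_zpow_eq_one h)).resolve_left hc)
  let ψ : G a b c c e f →* P :=
    G.lift (j (BS.u a b)) (j (BS.v a b)) (i α)
      (by rw [← map_inv, ← map_zpow, ← map_mul, ← map_mul, BS.rel, map_zpow])
      (by
        rw [← map_zpow, ← hij]
        exact conj_eq_of_commute (h0.map i))
      (conj_eq_of_eq_one hef (by rw [← map_zpow, (h2 e).2 dvd_rfl, map_one]))
  refine BS.injective_of_freelyGenerate hef _ (fun n hn => hz n (by simpa using hn)) ψ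
    (α := i α) (β := j (BS.u a b)) (by simp [ψ]) (by simp [ψ]) (fun n hn => ?_) (fun n hn => ?_)
    (hfree _ _ h3 fun m n hmn => ?_)
  · exact (h2 n).1 (hi (by rw [map_zpow, hn, map_one]))
  · exact BS.u_zpow_eq_one ha hb (hj (by rw [map_zpow, hn, map_one]))
  · rw [← zpow_mul] at hmn
    rw [hmn, BS.u_zpow_eq_v_zpow hmn, zpow_zero]

/-- As before, but the image of z inverts y^c, which is compatible with order |e| because e is even.
-/
theorem vertexZX_injective_of_neg (ha : a ≠ 0) (hb : b ≠ 0) (hc : c ≠ 0) (he : Even e)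
    (hef : f = e ∨ f = -e) (hz : ∀ n : ℤ, G.z a b c (-c) e f ^ n = 1 → n = 0) :
    Function.Injective (vertexZX a b c (-c) e f) := by
  obtain ⟨A, _, ρ, ζ, h1, h2, h3⟩ := exists_inverting he
  obtain ⟨P, _, i, j, hi, hj, hij, hfree⟩ := exists_amalgam ρ (BS.v a b ^ c) (fun n => by
    rw [← zpow_mul]
    refine ⟨fun h => ?_, fun h => ?_⟩
    · rw [(h3 n 0 (by simpa using h)).1, mul_zero, zpow_zero]
    · rw [(mul_eq_zero.1 (BS.v_zpow_eq_one h)).resolve_left hc, zpow_zero])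
  let ψ : G a b c (-c) e f →* P :=
    G.lift (j (BS.u a b)) (j (BS.v a b)) (i ζ)
      (by rw [← map_inv, ← map_zpow, ← map_mul, ← map_mul, BS.rel, map_zpow])
      (by
        rw [zpow_neg, ← map_zpow, ← hij, ← map_inv, ← map_inv, ← map_mul, ← map_mul]
        simpa using congrArg i (h1 1))
      (conj_eq_of_eq_one hef (by rw [← map_zpow, (h2 e).2 dvd_rfl, map_one]))
  refine BS.injective_of_freelyGenerate hef _ (fun n hn => hz n (by simpa using hn)) ψ
    (α := i ζ) (β := j (BS.u a b)) (by simp [ψ]) (by simp [ψ]) (fun n hn => ?_) (fun n hn => ?_)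
    (hfree _ _ (fun m n hmn => ?_) fun m n hmn => ?_)
  · exact (h2 n).1 (hi (by rw [map_zpow, hn, map_one]))
  · exact BS.u_zpow_eq_one ha hb (hj (by rw [map_zpow, hn, map_one]))
  · exact (h2 m).2 (h3 n m hmn.symm).2
  · rw [← zpow_mul] at hmn
    rw [hmn, BS.u_zpow_eq_v_zpow hmn, zpow_zero]

/-- Send x to an involution that commutes with an image of y of order |c| and inverts an image of z
of infinite order. -/
theorem vertexYZ_injective_of_neg (hab : a ≡ b [ZMOD 2]) (hcd : d = c ∨ d = -c)
    (hy : ∀ n : ℤ, G.y a b c d e (-e) ^ n = 1 → n = 0) :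
    Function.Injective (vertexYZ a b c d e (-e)) := by
  obtain ⟨A, _, g, α, g0, g1, g2, g3⟩ := exists_commute 2 c
  obtain ⟨B, _, ρ, ζ, h1, h2, h3⟩ := exists_inverting even_two
  obtain ⟨P, _, i, j, hi, hj, hij, hfree⟩ := exists_amalgam g ζ (fun n => by rw [g1, h2])
  let ψ : G a b c d e (-e) →* P :=
    G.lift (i g) (i α) (j ρ)
      (by
        rw [conj_eq_of_commute ((g0.map i).zpow_left a), ← map_zpow, ← map_zpow,
          zpow_eq_zpow_of_modEq ((g1 2).2 dvd_rfl) hab])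
      (conj_eq_of_eq_one hcd (by rw [← map_zpow, (g2 c).2 dvd_rfl, map_one]))
      (by rw [hij, ← map_zpow, ← map_inv, ← map_mul, ← map_mul, h1, map_zpow])
  refine BS.injective_of_freelyGenerate hcd _ (fun n hn => hy n (by simpa using hn)) ψ
    (α := i α) (β := j ρ) (by simp [ψ]) (by simp [ψ]) (fun n hn => ?_) (fun n hn => ?_)
    (hfree _ _ g3 fun m n hmn => ?_)
  · exact (g2 n).1 (hi (by rw [map_zpow, hn, map_one]))
  · exact (h3 n 0 (by rw [zpow_zero]; exact hj (by rw [map_zpow, hn, map_one]))).1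
  · rw [(h3 m n hmn).1, zpow_zero]

theorem vertexXY_injective_of_all_neg (he : e ≠ 0) :
    Function.Injective (vertexXY a (-a) c (-c) e (-e)) := by
  obtain ⟨A, _, g, α, g0, g1, g2, g3⟩ := exists_commute 2 a
  -- With order 2|e|, ζ^e is an involution: it equals ζ^(-e) and, identified with g, commutes with
  -- the image of x.
  obtain ⟨B, _, ρ, ζ, h1, h2, h3⟩ := exists_inverting (even_two_mul e)
  have hζ (n : ℤ) : (ζ ^ e) ^ n = 1 ↔ 2 ∣ n := by
    rw [← zpow_mul, h2, mul_comm 2, mul_dvd_mul_iff_left he]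
  obtain ⟨P, _, i, j, hi, hj, hij, hfree⟩ := exists_amalgam g (ζ ^ e)
    (fun n => by rw [g1, hζ])
  let ψ : G a (-a) c (-c) e (-e) →* P :=
    G.lift (i α) (j ρ) (j ζ)
      (conj_eq_of_eq_one (Or.inr rfl) (by rw [← map_zpow, (g2 a).2 dvd_rfl, map_one]))
      (by rw [← map_zpow, ← map_inv, ← map_mul, ← map_mul, h1, map_zpow])
      (by
        rw [← map_zpow, ← map_zpow, ← hij, conj_eq_of_commute (g0.map i), hij]
        congr 1
        rw [zpow_neg, eq_inv_iff_mul_eq_one, ← zpow_two, hζ])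
  refine BS.injective_of_freelyGenerate (Or.inr rfl) _
    (fun n hn => x_zpow_eq_one_of_neg (by simpa using hn)) ψ
    (α := i α) (β := j ρ) (by simp [ψ]) (by simp [ψ]) (fun n hn => ?_) (fun n hn => ?_)
    (hfree _ _ g3 fun m n hmn => ?_)
  · exact (g2 n).1 (hi (by rw [map_zpow, hn, map_one]))
  · exact (h3 n 0 (by rw [zpow_zero]; exact hj (by rw [map_zpow, hn, map_one]))).1
  · rw [← zpow_mul] at hmn
    rw [(h3 _ _ hmn).1, zpow_zero]

theorem vertexYZ_injective_of_vertexXY (h : Function.Injective (vertexXY c d e f a b)) :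
    Function.Injective (vertexYZ a b c d e f) := by
  let ρ : G a b c d e f →* G c d e f a b :=
    G.lift (G.z c d e f a b) (G.x c d e f a b) (G.y c d e f a b)
      (G.rel_z ..) (G.rel_x ..) (G.rel_y ..)
  exact injective_of_comp_eq (ρ := ρ) (σ := MonoidHom.id _) Function.injective_id h
    (BS.hom_ext (by simp [ρ]) (by simp [ρ]))

theorem vertexZX_injective_of_vertexXY (h : Function.Injective (vertexXY e f a b c d)) :
    Function.Injective (vertexZX a b c d e f) := by
  let ρ : G a b c d e f →* G e f a b c d :=
    G.lift (G.y e f a b c d) (G.z e f a b c d) (G.x e f a b c d)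
      (G.rel_y ..) (G.rel_z ..) (G.rel_x ..)
  exact injective_of_comp_eq (ρ := ρ) (σ := MonoidHom.id _) Function.injective_id h
    (BS.hom_ext (by simp [ρ]) (by simp [ρ]))

end Vertices

theorem IsSpecial.developable (h : IsSpecial a b c d e f) (ha : a ≠ 0) (hb : b ≠ 0) (hc : c ≠ 0)
    (hd : d ≠ 0) (he : e ≠ 0) (hf : f ≠ 0) : Developable a b c d e f := by
  induction h with
  | case1 a c e =>
    exact ⟨vertexXY_injective_of_all_neg he,
      vertexYZ_injective_of_vertexXY (vertexXY_injective_of_all_neg ha),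
      vertexZX_injective_of_vertexXY (vertexXY_injective_of_all_neg hc)⟩
  | case2 a b c e =>
    exact ⟨vertexXY_injective_of_eq rfl, vertexYZ_injective_of_eq rfl,
      vertexZX_injective_of_eq ha hb hc (Or.inl rfl) fun n => z_zpow_eq_one_of_eq rfl⟩
  | case3 a b c e hab =>
    exact ⟨vertexXY_injective_of_eq rfl,
      vertexYZ_injective_of_neg hab (Or.inl rfl) fun n => y_zpow_eq_one_of_eq rfl,
      vertexZX_injective_of_eq ha hb hc (Or.inr rfl) fun n => z_zpow_eq_one_of_neg hab⟩
  | case4 a b c e hev =>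
    exact ⟨vertexXY_injective_of_neg hc hev (Or.inl rfl), vertexYZ_injective_of_eq rfl,
      vertexZX_injective_of_neg ha hb hc hev (Or.inl rfl) fun n => z_zpow_eq_one_of_eq rfl⟩
  | case5 a b c e hev hab =>
    exact ⟨vertexXY_injective_of_neg hc hev (Or.inr rfl),
      vertexYZ_injective_of_neg hab (Or.inr rfl) fun n => y_zpow_eq_one_of_neg hev hev.neg,
      vertexZX_injective_of_neg ha hb hc hev (Or.inr rfl) fun n => z_zpow_eq_one_of_neg hab⟩
  | rotate a b c d e f _ ih => exact (ih he hf ha hb hc hd).rotate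
  | exchange a b c d e f _ ih => exact (ih hb ha hc hd he hf).exchange
  | negate a b c d e f _ ih =>
    exact (ih (neg_ne_zero.1 ha) (neg_ne_zero.1 hb) hc hd he hf).negate

end Examples

end BSTriangle

theorem theorem1 (a b c d e f : ℤ)
    (ha : a ≠ 0) (hb : b ≠ 0) (hc : c ≠ 0) (hd : d ≠ 0) (he : e ≠ 0) (hf : f ≠ 0) :
    ((a ∣ b ∨ b ∣ a ∨ c ∣ d ∨ d ∣ c ∨ e ∣ f ∨ f ∣ e) →
      ¬ BSTriangle.IsSpecial a b c d e f → ¬ BSTriangle.Developable a b c d e f) ∧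
    (BSTriangle.IsSpecial a b c d e f → BSTriangle.Developable a b c d e f) := by
  refine ⟨fun hdvd hs h => hs ?_, fun h => h.developable ha hb hc hd he hf⟩
  rcases hdvd with h1 | h1 | h1 | h1 | h1 | h1
  · exact h.isSpecial_of_dvd_or_dvd ha hb hc hd he hf (Or.inl h1)
  · exact h.isSpecial_of_dvd_or_dvd ha hb hc hd he hf (Or.inr h1)
  -- Rotation has order three, so two further rotations undo one.
  · exact .rotate _ _ _ _ _ _ (.rotate _ _ _ _ _ _
      (h.rotate.isSpecial_of_dvd_or_dvd hc hd he hf ha hb (Or.inl h1)))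
  · exact .rotate _ _ _ _ _ _ (.rotate _ _ _ _ _ _
      (h.rotate.isSpecial_of_dvd_or_dvd hc hd he hf ha hb (Or.inr h1)))
  · exact .rotate _ _ _ _ _ _
      (h.rotate.rotate.isSpecial_of_dvd_or_dvd he hf ha hb hc hd (Or.inl h1))
  · exact .rotate _ _ _ _ _ _
      (h.rotate.rotate.isSpecial_of_dvd_or_dvd he hf ha hb hc hd (Or.inr h1))
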